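/- Let $\mathcal H$ be a separable complex Hilbert space, $A$ a closed linear operator in $\mathcal H$ with domain $\mathrm{Dom}(A)\subseteq\mathcal H$ (bounded, with $\mathrm{Dom}(A)=\mathcal H$, or unbounded), $(\Omega,\mathrm d\omega)$ a $\sigma$-finite measure space, $\sigma:\Omega\to\mathbb C$ a measurable function and $\varepsilon>0$. Let $\Lambda$ be the operator $(\Lambda\phi)(\omega)=\sigma(\omega)\phi(\omega)$ in $L^1(\Omega,\mathrm d\omega)$ with its maximal domain $\mathrm{Dom}(\Lambda)=\{\phi\in L^1:\sigma\phi\in L^1\}$, and for measurable $U\subseteq\Omega$ let $P_U$ be multiplication by the characteristic function of $U$ on $L^1(\Omega,\mathrm d\omega)$. For a bounded linear operator $E:L^1(\Omega,\mathrm d\omega)\to\mathcal H$ consider the condition (C) $\|EP_U\|=1$ for every measurable $U\subseteq\Omega$ of positive measure, $E(\mathrm{Dom}(\Lambda))\subseteq\mathrm{Dom}(A)$, and $\|AE-E\Lambda\|<\varepsilon$, that is, $AE-E\Lambda$ is bounded on $\mathrm{Dom}(\Lambda)$ with respect to the $L^1$ norm, with operator norm less than $\varepsilon$. For a null set $N\subseteq\Omega$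 and a family $(e_\omega)_{\omega\in\Omega\setminus N}$ in $\mathcal H$ consider the condition (F) $\omega\mapsto e_\omega$ is measurable on $\Omega\setminus N$, and there is $\varepsilon'$ with $0<\varepsilon'<\varepsilon$ such that, for all $\omega\in\Omega\setminus N$, $e_\omega\in\mathrm{Dom}(A)$, $\|e_\omega\|=1$ and $\|Ae_\omega-\sigma(\omega)e_\omega\|\le\varepsilon'$. Then: 1. There is a bounded linear operator $E:L^1(\Omega,\mathrm d\omega)\to\mathcal H$ satisfying (C) if and only if there are a null set $N$ and a family $(e_\omega)_{\omega\in\Omega\setminus N}$ satisfying (F). 2. More precisely, a bounded linear operator $E:L^1(\Omega,\mathrm d\omega)\to\mathcal H$ satisfies (C) if and only if there are a null set $N$ and a family $(e_\omega)_{\omega\in\Omega\setminus N}$ satisfying (F) such that, for all $\phi\in L^1(\Omega,\mathrm d\omega)$, $\omega\mapsto\phi(\omega)e_\omega$ is integrable and $$E\phi=\int_\Omega\phi(\omega)\,e_\omega\,\mathrm d\omega .$$ 3. For every null set $N$ and every family satisfying (F), this formula (the integrals being absolutely convergent) defines a bounded linear operator $E:L^1(\Omega,\mathrm d\omega)\to\mathcal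 H$ that satisfies (C). -/

import Mathlib

open MeasureTheory Set
open scoped ENNReal

namespace ApproxSpectral

section Multiplication

variable {Ω : Type*} [MeasurableSpace Ω] (μ : Measure Ω) (p : ℝ≥0∞)

/-- The maximal domain in `L^p(Ω, μ)` of multiplication by `σ`: all `φ ∈ L^p` with `σ φ ∈ L^p`. -/
def multDomain (σ : Ω → ℂ) : Submodule ℂ (Lp ℂ p μ) where
  carrier := {φ | MemLp (fun ω => σ ω * φ ω) p μ}
  zero_mem' := by
    have h : (fun ω => σ ω * (0 : Lp ℂ p μ) ω) =ᵐ[μ] fun _ => (0 : ℂ) := by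
      filter_upwards [Lp.coeFn_zero ℂ p μ] with ω hω
      rw [hω, Pi.zero_apply, mul_zero]
    exact (memLp_congr_ae h).2 MemLp.zero
  add_mem' := by
    intro φ ψ hφ hψ
    have h : (fun ω => σ ω * (φ + ψ) ω) =ᵐ[μ] fun ω => σ ω * φ ω + σ ω * ψ ω := by
      filter_upwards [Lp.coeFn_add φ ψ] with ω hω
      rw [hω, Pi.add_apply, mul_add]
    exact (memLp_congr_ae h).2 (MemLp.add hφ hψ)
  smul_mem' := by
    intro c φ hφ
    have h : (fun ω => σ ω * (c • φ) ω) =ᵐ[μ] fun ω => c * (σ ω * φ ω) := by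
      filter_upwards [Lp.coeFn_smul c φ] with ω hω
      simp only [hω, Pi.smul_apply, smul_eq_mul]
      ring
    exact (memLp_congr_ae h).2 (MemLp.const_mul hφ c)

theorem memLp_of_mem_multDomain {σ : Ω → ℂ} (φ : multDomain μ p σ) :
    MemLp (fun ω => σ ω * (φ : Lp ℂ p μ) ω) p μ := φ.2

/-- The multiplication operator `(Λ φ)(ω) = σ(ω) φ(ω)` on its maximal domain in `L^p(Ω, μ)`. -/
noncomputable def multOp (σ : Ω → ℂ) : Lp ℂ p μ →ₗ.[ℂ] Lp ℂ p μ where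
  domain := multDomain μ p σ
  toFun :=
    { toFun := fun φ => (memLp_of_mem_multDomain μ p φ).toLp _
      map_add' := by
        intro φ ψ
        rw [← MemLp.toLp_add]
        refine MemLp.toLp_congr _ _ ?_
        filter_upwards [Lp.coeFn_add (φ : Lp ℂ p μ) (ψ : Lp ℂ p μ)] with ω hω
        rw [Submodule.coe_add, hω, Pi.add_apply, mul_add]
        rfl
      map_smul' := by
        intro c φ
        rw [RingHom.id_apply, ← MemLp.toLp_const_smul]
        refine MemLp.toLp_congr _ _ ?_
        filter_upwards [Lp.coeFn_smul c (φ : Lp ℂ p μ)] with ω hω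
        simp only [Submodule.coe_smul, hω, Pi.smul_apply, smul_eq_mul]
        ring }

/-- The operator `P_U` on `L^p(Ω, μ)` of multiplication by the characteristic function of the
measurable set `U`. -/
noncomputable def indicatorOp [Fact (1 ≤ p)] {U : Set Ω} (hU : MeasurableSet U) :
    Lp ℂ p μ →L[ℂ] Lp ℂ p μ :=
  LinearMap.mkContinuous
    { toFun := fun φ => ((Lp.memLp φ).indicator hU).toLp (U.indicator φ)
      map_add' := by
        intro φ ψ
        rw [← MemLp.toLp_add]
        refine MemLp.toLp_congr _ _ ?_
        filter_upwards [Lp.coeFn_add φ ψ] with ω hω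
        by_cases h : ω ∈ U
        · simp only [Pi.add_apply, indicator_of_mem h]
          rw [hω, Pi.add_apply]
        · simp only [Pi.add_apply, indicator_of_notMem h, add_zero]
      map_smul' := by
        intro c φ
        rw [RingHom.id_apply, ← MemLp.toLp_const_smul]
        refine MemLp.toLp_congr _ _ ?_
        filter_upwards [Lp.coeFn_smul c φ] with ω hω
        by_cases h : ω ∈ U <;> simp [h, hω] } 1 (by
      intro φ
      rw [one_mul]
      refine Lp.norm_le_norm_of_ae_le ?_
      filter_upwards [((Lp.memLp φ).indicator hU).coeFn_toLp] with ω hω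
      simp only [LinearMap.coe_mk, AddHom.coe_mk, hω]
      exact norm_indicator_le_norm_self _ _)

end Multiplication

section Conditions

variable {Ω : Type*} [MeasurableSpace Ω] {H : Type*} [NormedAddCommGroup H]
  [InnerProductSpace ℂ H]

/-- `‖A E - E Λ‖ < ε`, where `A` and `Λ` may be unbounded: `E` maps `Dom Λ` into `Dom A`, and
`A E - E Λ`, defined on `Dom Λ`, is bounded there with operator norm less than `ε`. -/
def CommutatorNormLT {X : Type*} [NormedAddCommGroup X] [NormedSpace ℂ X]
    (A : H →ₗ.[ℂ] H) (Λ : X →ₗ.[ℂ] X) (E : X →L[ℂ] H) (ε : ℝ) : Prop :=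
  ∃ hdom : ∀ φ : Λ.domain, E φ ∈ A.domain,
    ∃ C : ℝ, 0 ≤ C ∧ C < ε ∧ ∀ φ : Λ.domain, ‖A ⟨E φ, hdom φ⟩ - E (Λ φ)‖ ≤ C * ‖(φ : X)‖

/-- `E : L^p(Ω, μ) → H` is an approximate diagonalization of `A` with symbol `σ` and error less
than `ε`: `‖E P_U‖ = 1` for all `U` of positive measure, and `‖A E - E Λ‖ < ε`. -/
structure IsApproxDiagonalization (μ : Measure Ω) (p : ℝ≥0∞) [Fact (1 ≤ p)]
    (A : H →ₗ.[ℂ] H) (σ : Ω → ℂ) (ε : ℝ) (E : Lp ℂ p μ →L[ℂ] H) : Prop where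
  norm_comp_indicatorOp : ∀ (U : Set Ω) (hU : MeasurableSet U), 0 < μ U →
    ‖E.comp (indicatorOp μ p hU)‖ = 1
  commutator : CommutatorNormLT A (multOp μ p σ) E ε

/-- `e` is a family of unit vectors in `Dom A`, defined and measurable on the complement of the
null set `N` (its values on `N` are irrelevant), with `‖A e_ω - σ(ω) e_ω‖ ≤ ε'` off `N`. -/
structure IsPseudoEigenfamily [MeasurableSpace H] (μ : Measure Ω)
    (A : H →ₗ.[ℂ] H) (σ : Ω → ℂ) (ε' : ℝ) (N : Set Ω) (e : Ω → H) : Prop where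
  null : μ N = 0
  measurable : Measurable fun ω : (Nᶜ : Set Ω) => e ω
  norm_eq_one : ∀ ω ∈ Nᶜ, ‖e ω‖ = 1
  residual : ∀ ω ∈ Nᶜ, ∃ h : e ω ∈ A.domain, ‖A ⟨e ω, h⟩ - σ ω • e ω‖ ≤ ε'

/-- `E φ = ∫ φ(ω) e_ω dμ(ω)` for all `φ ∈ L^p(Ω, μ)`, the integrals being absolutely convergent. -/
def IsIntegralOf (μ : Measure Ω) (p : ℝ≥0∞) [Fact (1 ≤ p)]
    (E : Lp ℂ p μ →L[ℂ] H) (e : Ω → H) : Prop :=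
  ∀ φ : Lp ℂ p μ, Integrable (fun ω => φ ω • e ω) μ ∧ E φ = ∫ ω, φ ω • e ω ∂μ

end Conditions

end ApproxSpectral

/-! ### Averages in closed sets, and a Hilbert space Radon–Nikodym theorem. -/

namespace MeasureTheory

/-! A Hilbert space has the Radon–Nikodym property: bounded operators `E` on `L¹` are exactly the
integrals against essentially bounded densities `e` (`exists_stronglyMeasurable_isIntegralOf`,
`exists_isIntegralOf`). The norm of `E P_U` is the essential supremum of `‖e‖` on `U`, so it is 1
for all non-null `U` iff `‖e‖ = 1` a.e.

Formally `A E - E Λ` has density `A e - σ e`, so its bound is a pointwise residual bound. Closedness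
of `A` justifies this both ways through the graph, a closed subspace of `H × H`. Integrals of
graph-valued functions stay in the graph (`IsPseudoEigenfamily.commutatorNormLT`); conversely, a
function whose averages lie in the graph is a.e. graph-valued
(`IsIntegralOf.ae_residual_le_of_bounded`). -/

/-- If all averages of `f` over sets of finite positive measure lie in the closed set `K`, then
`f` takes values in `K` almost everywhere. -/
theorem ae_mem_of_forall_setAverage_mem {α E : Type*} [MeasurableSpace α] {μ : Measure α}
    [SigmaFinite μ] [NormedAddCommGroup E] [NormedSpace ℝ E] [CompleteSpace E]
    [SecondCountableTopology E] {f : α → E} (hf : AEStronglyMeasurable f μ) {K : Set E}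
    (hK : IsClosed K)
    (h : ∀ s, MeasurableSet s → 0 < μ s → μ s < ∞ → IntegrableOn f s μ → ⨍ x in s, f x ∂μ ∈ K) :
    ∀ᵐ x ∂μ, f x ∈ K := by
  borelize E
  obtain ⟨g, hg, hfg⟩ := hf
  have hball : ∀ y ∈ Kᶜ, ∃ r : ℝ, 0 < r ∧ Metric.closedBall y r ⊆ Kᶜ := fun y hy =>
    Metric.nhds_basis_closedBall.mem_iff.1 (hK.isOpen_compl.mem_nhds hy)
  choose! r hr hrK using hball
  obtain ⟨t, htK, ht, htU⟩ := TopologicalSpace.countable_cover_nhdsWithin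
    (f := fun y => Metric.closedBall y (r y))
    fun y hy => mem_nhdsWithin_of_mem_nhds (Metric.closedBall_mem_nhds y (hr y hy))
  -- Otherwise some piece of this preimage has finite positive measure; by convexity the average
  -- over it lies in the ball, which misses `K`.
  have key : ∀ y ∈ Kᶜ, μ (g ⁻¹' Metric.closedBall y (r y)) = 0 := by
    intro y hy
    by_contra hne
    obtain ⟨s, hs, hsub, hpos, hlt⟩ := Measure.exists_subset_measure_lt_top
      (hg.measurable Metric.isClosed_closedBall.measurableSet) (pos_iff_ne_zero.2 hne)
    have hmem : ∀ᵐ x ∂μ.restrict s, f x ∈ Metric.closedBall y (r y) := by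
      filter_upwards [ae_restrict_of_ae hfg, ae_restrict_mem hs] with x hx hxs
      rw [hx]
      exact hsub hxs
    have hint : IntegrableOn f s μ := by
      refine Measure.integrableOn_of_bounded hlt.ne ⟨g, hg, hfg⟩ (M := ‖y‖ + r y) ?_
      filter_upwards [hmem] with x hx
      exact norm_le_of_mem_closedBall hx
    exact hrK y hy ((convex_closedBall y (r y)).set_average_mem Metric.isClosed_closedBall
      hpos.ne' hlt.ne hmem hint) (h s hs hpos hlt hint)
  have hall : ∀ᵐ x ∂μ, ∀ y ∈ t, g x ∉ Metric.closedBall y (r y) :=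
    (ae_ball_iff ht).2 fun y hy => measure_eq_zero_iff_ae_notMem.1 (key y (htK hy))
  filter_upwards [hfg, hall] with x hx hxt
  by_contra hxK
  rw [hx] at hxK
  obtain ⟨y, hy, hxy⟩ := mem_iUnion₂.1 (htU hxK)
  exact hxt y hy hxy

/-- Radon–Nikodym theorem for Hilbert space valued set functions dominated by a finite measure. -/
theorem DominatedFinMeasAdditive.exists_setIntegral_eq {α H : Type*} [MeasurableSpace α]
    {μ : Measure α} [IsFiniteMeasure μ] [NormedAddCommGroup H] [InnerProductSpace ℝ H]
    [CompleteSpace H] {m : Set α → H} {C : ℝ} (hC : 0 ≤ C)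
    (hm : DominatedFinMeasAdditive μ m C) :
    ∃ e : α → H, Integrable e μ ∧ ∀ s, MeasurableSet s → ∫ x in s, e x ∂μ = m s := by
  have hT : DominatedFinMeasAdditive μ (fun s => innerSL ℝ (m s)) C := by
    refine ⟨fun s t hs ht hμs hμt hst => ?_, fun s hs hμs => ?_⟩
    · simp only [hm.1 s t hs ht hμs hμt hst, map_add]
    · rw [innerSL_apply_norm]
      exact hm.2 s hs hμs
  have hint : ∀ f : Lp H 2 μ, Integrable f μ := fun f => (Lp.memLp f).integrable one_le_two
  -- `L f = ∫ ⟨dm, f⟩` is bounded on `L²` because `L² ⊆ L¹` for a finite measure; its Riesz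
  -- representative is the density.
  let L : Lp H 2 μ →L[ℝ] ℝ := LinearMap.mkContinuous
    { toFun := fun f => setToFun μ _ hT f
      map_add' := fun f g => by
        rw [← setToFun_add hT (hint f) (hint g)]
        exact setToFun_congr_ae hT (Lp.coeFn_add f g)
      map_smul' := fun c f => by
        rw [RingHom.id_apply, ← setToFun_smul hT (fun c s x => by simp) c f]
        exact setToFun_congr_ae hT (Lp.coeFn_smul c f) }
    (C * (μ univ ^ (1 / (1 : ℝ≥0∞).toReal - 1 / (2 : ℝ≥0∞).toReal)).toReal) (by
      intro f
      refine (norm_setToFun_le hT (hint f) hC).trans ?_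
      rw [mul_assoc, mul_comm _ ‖f‖]
      refine mul_le_mul_of_nonneg_left ?_ hC
      have hle := eLpNorm_le_eLpNorm_mul_rpow_measure_univ (p := 1) (q := 2) one_le_two
        (Lp.memLp f).aestronglyMeasurable
      rw [Integrable.toL1, Lp.norm_toLp, Lp.norm_def, ← ENNReal.toReal_mul]
      refine ENNReal.toReal_mono (ENNReal.mul_ne_top (Lp.eLpNorm_ne_top f) ?_) hle
      refine ENNReal.rpow_ne_top_of_nonneg (by norm_num) (measure_ne_top μ univ))
  refine ⟨(InnerProductSpace.toDual ℝ (Lp H 2 μ)).symm L, hint _, fun s hs => ?_⟩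
  refine ext_inner_left ℝ fun c => ?_
  rw [← L2.inner_indicatorConstLp_eq_inner_setIntegral ℝ hs (measure_ne_top μ s), real_inner_comm,
    InnerProductSpace.toDual_symm_apply, real_inner_comm]
  change setToFun μ _ hT (indicatorConstLp 2 hs (measure_ne_top μ s) c) = _
  rw [setToFun_congr_ae hT indicatorConstLp_coeFn,
    setToFun_indicator_const hT hs (measure_ne_top μ s)]
  rfl

theorem aestronglyMeasurable_of_measurable_compl_null {α E : Type*} [MeasurableSpace α]
    {μ : Measure α} [TopologicalSpace E] [TopologicalSpace.PseudoMetrizableSpace E]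
    [SecondCountableTopology E] [MeasurableSpace E] [OpensMeasurableSpace E] [Zero E]
    {N : Set α} (hN : μ N = 0) {f : α → E} (hf : Measurable fun x : (Nᶜ : Set α) => f x) :
    AEStronglyMeasurable f μ := by
  -- `N` need not be measurable, so its measurable hull, still null, is removed instead.
  have hM : MeasurableSet (toMeasurable μ N)ᶜ := (measurableSet_toMeasurable μ N).compl
  have hsub : (toMeasurable μ N)ᶜ ⊆ Nᶜ := compl_subset_compl.2 (subset_toMeasurable μ N)
  have hr : Measurable fun x : ((toMeasurable μ N)ᶜ : Set α) => f x :=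
    hf.comp (measurable_inclusion hsub)
  have hmeas : Measurable ((toMeasurable μ N)ᶜ.indicator f) := by
    refine measurable_of_restrict_of_restrict_compl hM ?_ ?_
    · convert! hr using 1
      ext x
      exact indicator_of_mem x.2 f
    · convert! (measurable_const : Measurable fun _ => (0 : E)) using 1
      ext x
      exact indicator_of_notMem x.2 f
  refine ⟨_, hmeas.stronglyMeasurable, ?_⟩
  have h0 : μ (toMeasurable μ N) = 0 := by rw [measure_toMeasurable, hN]
  filter_upwards [measure_eq_zero_iff_ae_notMem.1 h0] with x hx
  rw [indicator_of_mem hx]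

end MeasureTheory

/-! ### Operators on `L¹` with a density; representation over a finite measure. -/

namespace ApproxSpectral

theorem smul_indicator_eq_indicator_smul {Ω H : Type*} [AddCommGroup H] [Module ℂ H]
    (U : Set Ω) (φ : Ω → ℂ) (e : Ω → H) :
    (fun ω => φ ω • U.indicator e ω) = fun ω => U.indicator φ ω • e ω := by
  ext ω
  by_cases h : ω ∈ U <;> simp [h]

section

variable {Ω : Type*} [MeasurableSpace Ω] {μ : Measure Ω} {H : Type*} [NormedAddCommGroup H]
  [InnerProductSpace ℂ H]

theorem indicatorOp_coeFn {p : ℝ≥0∞} [Fact (1 ≤ p)] {U : Set Ω} (hU : MeasurableSet U)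
    (φ : Lp ℂ p μ) : indicatorOp μ p hU φ =ᵐ[μ] U.indicator φ :=
  ((Lp.memLp φ).indicator hU).coeFn_toLp

theorem multOp_coeFn {p : ℝ≥0∞} {σ : Ω → ℂ} (φ : (multOp μ p σ).domain) :
    multOp μ p σ φ =ᵐ[μ] fun ω => σ ω * (φ : Lp ℂ p μ) ω :=
  (memLp_of_mem_multDomain μ p φ).coeFn_toLp

theorem IsIntegralOf.comp_indicatorOp {p : ℝ≥0∞} [Fact (1 ≤ p)] {E : Lp ℂ p μ →L[ℂ] H}
    {e : Ω → H} (h : IsIntegralOf μ p E e) {U : Set Ω} (hU : MeasurableSet U) :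
    IsIntegralOf μ p (E.comp (indicatorOp μ p hU)) (U.indicator e) := by
  intro φ
  have hae : (fun ω => indicatorOp μ p hU φ ω • e ω) =ᵐ[μ] fun ω => φ ω • U.indicator e ω := by
    rw [smul_indicator_eq_indicator_smul]
    filter_upwards [indicatorOp_coeFn hU φ] with ω hω
    rw [hω]
  obtain ⟨hint, heq⟩ := h (indicatorOp μ p hU φ)
  exact ⟨(integrable_congr hae).1 hint, heq.trans (integral_congr_ae hae)⟩

theorem integrable_smul_of_ae_norm_le {φ : Ω → ℂ} (hφ : Integrable φ μ) {e : Ω → H}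
    (he : AEStronglyMeasurable e μ) {c : ℝ} (hc : ∀ᵐ ω ∂μ, ‖e ω‖ ≤ c) :
    Integrable (fun ω => φ ω • e ω) μ :=
  hφ.smul_bdd (φ := φ) c he hc

theorem norm_integral_smul_le {φ : Lp ℂ 1 μ} {e : Ω → H} {c : ℝ}
    (hc : ∀ᵐ ω ∂μ, ‖e ω‖ ≤ c) : ‖∫ ω, φ ω • e ω ∂μ‖ ≤ c * ‖φ‖ := by
  rw [L1.norm_eq_integral_norm, ← integral_const_mul]
  refine norm_integral_le_of_norm_le ((L1.integrable_coeFn φ).norm.const_mul c) ?_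
  filter_upwards [hc] with ω hω
  rw [norm_smul, mul_comm]
  exact mul_le_mul_of_nonneg_right hω (norm_nonneg _)

/-- The bounded operator `φ ↦ ∫ φ e` on `L¹` defined by an essentially bounded family `e`. -/
theorem exists_isIntegralOf {e : Ω → H} (he : AEStronglyMeasurable e μ) {c : ℝ}
    (hc : ∀ᵐ ω ∂μ, ‖e ω‖ ≤ c) : ∃ E : Lp ℂ 1 μ →L[ℂ] H, IsIntegralOf μ 1 E e := by
  have hint : ∀ φ : Lp ℂ 1 μ, Integrable (fun ω => φ ω • e ω) μ := fun φ =>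
    integrable_smul_of_ae_norm_le (L1.integrable_coeFn φ) he hc
  refine ⟨LinearMap.mkContinuous
    { toFun := fun φ => ∫ ω, φ ω • e ω ∂μ
      map_add' := fun φ ψ => by
        rw [← integral_add (hint φ) (hint ψ)]
        refine integral_congr_ae ?_
        filter_upwards [Lp.coeFn_add φ ψ] with ω hω
        rw [hω, Pi.add_apply, add_smul]
      map_smul' := fun a φ => by
        rw [RingHom.id_apply, ← integral_smul]
        refine integral_congr_ae ?_
        filter_upwards [Lp.coeFn_smul a φ] with ω hω
        rw [hω, Pi.smul_apply, smul_assoc] } c fun φ => norm_integral_smul_le hc,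
    fun φ => ⟨hint φ, rfl⟩⟩

theorem IsIntegralOf.norm_le {E : Lp ℂ 1 μ →L[ℂ] H} {e : Ω → H} (h : IsIntegralOf μ 1 E e)
    {c : ℝ} (hc0 : 0 ≤ c) (hc : ∀ᵐ ω ∂μ, ‖e ω‖ ≤ c) : ‖E‖ ≤ c :=
  E.opNorm_le_bound hc0 fun φ => (h φ).2 ▸ norm_integral_smul_le hc

theorem IsIntegralOf.setIntegral_eq {E : Lp ℂ 1 μ →L[ℂ] H} {e : Ω → H}
    (h : IsIntegralOf μ 1 E e) {s : Set Ω} (hs : MeasurableSet s) (hμs : μ s ≠ ∞) :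
    ∫ ω in s, e ω ∂μ = E (indicatorConstLp 1 hs hμs 1) := by
  rw [(h _).2, ← integral_indicator hs]
  refine integral_congr_ae ?_
  filter_upwards [indicatorConstLp_coeFn (p := 1) (hs := hs) (hμs := hμs) (c := (1 : ℂ))]
    with ω hω
  rw [hω]
  by_cases hω : ω ∈ s <;> simp [hω]

theorem ae_norm_le_of_norm_setIntegral_le [SigmaFinite μ] [CompleteSpace H]
    [SecondCountableTopology H] {e : Ω → H} (he : AEStronglyMeasurable e μ) {c : ℝ}
    (h : ∀ s, MeasurableSet s → μ s < ∞ → ‖∫ ω in s, e ω ∂μ‖ ≤ c * μ.real s) :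
    ∀ᵐ ω ∂μ, ‖e ω‖ ≤ c := by
  have := ae_mem_of_forall_setAverage_mem he (K := Metric.closedBall 0 c)
    Metric.isClosed_closedBall fun s hs hpos hlt _ => by
      have hr : 0 < μ.real s := ENNReal.toReal_pos hpos.ne' hlt.ne
      rw [mem_closedBall_zero_iff, setAverage_eq, norm_smul, norm_inv, Real.norm_of_nonneg hr.le,
        inv_mul_le_iff₀ hr, mul_comm]
      exact h s hs hlt
  simpa using this

theorem norm_apply_indicatorConstLp_le (E : Lp ℂ 1 μ →L[ℂ] H) {s : Set Ω}
    (hs : MeasurableSet s) (hμs : μ s ≠ ∞) :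
    ‖E (indicatorConstLp 1 hs hμs 1)‖ ≤ ‖E‖ * μ.real s := by
  refine (E.le_opNorm _).trans_eq ?_
  rw [norm_indicatorConstLp one_ne_zero ENNReal.one_ne_top]
  simp

/-- Testing `E` on indicators bounds the averages of `e`. With `IsIntegralOf.norm_le` this makes
`‖E‖` the essential supremum of `‖e‖`. -/
theorem IsIntegralOf.ae_norm_le [SigmaFinite μ] [CompleteSpace H] [SecondCountableTopology H]
    {E : Lp ℂ 1 μ →L[ℂ] H} {e : Ω → H} (h : IsIntegralOf μ 1 E e)
    (he : AEStronglyMeasurable e μ) : ∀ᵐ ω ∂μ, ‖e ω‖ ≤ ‖E‖ :=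
  ae_norm_le_of_norm_setIntegral_le he fun s hs hμs => by
    rw [h.setIntegral_eq hs hμs.ne]
    exact norm_apply_indicatorConstLp_le E hs hμs.ne

/-- A bounded operator on `L¹` of a finite measure space with values in a Hilbert space is an
integral operator. -/
theorem exists_integral_eq_of_isFiniteMeasure [IsFiniteMeasure μ] [CompleteSpace H]
    [SecondCountableTopology H] (E : Lp ℂ 1 μ →L[ℂ] H) :
    ∃ e : Ω → H, AEStronglyMeasurable e μ ∧ (∀ᵐ ω ∂μ, ‖e ω‖ ≤ ‖E‖) ∧ IsIntegralOf μ 1 E e := by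
  classical
  let m : Set Ω → H := fun s =>
    if hs : MeasurableSet s then E (indicatorConstLp 1 hs (measure_ne_top μ s) 1) else 0
  have hm_apply : ∀ s (hs : MeasurableSet s),
      m s = E (indicatorConstLp 1 hs (measure_ne_top μ s) 1) := fun s hs => dif_pos hs
  have hm : DominatedFinMeasAdditive μ m ‖E‖ := by
    refine ⟨fun s t hs ht hμs hμt hst => ?_, fun s hs hμs => ?_⟩
    · rw [hm_apply _ (hs.union ht), hm_apply s hs, hm_apply t ht, ← map_add,
        ← indicatorConstLp_disjoint_union hs ht hμs hμt hst]
    · rw [hm_apply s hs]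
      exact norm_apply_indicatorConstLp_le E hs hμs.ne
  -- The density depends only on the set function `m`, so real scalars suffice to find it; complex
  -- linearity returns in comparing `E` with `F` on indicators.
  let _ : InnerProductSpace ℝ H := InnerProductSpace.complexToReal
  obtain ⟨e, he, hem⟩ := hm.exists_setIntegral_eq (norm_nonneg E)
  have hbound : ∀ᵐ ω ∂μ, ‖e ω‖ ≤ ‖E‖ :=
    ae_norm_le_of_norm_setIntegral_le he.aestronglyMeasurable fun s hs hμs => by
      rw [hem s hs]
      exact hm.2 s hs hμs
  obtain ⟨F, hF⟩ := exists_isIntegralOf he.aestronglyMeasurable hbound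
  refine ⟨e, he.aestronglyMeasurable, hbound, ?_⟩
  have hEF : E = F := by
    ext φ
    refine Lp.induction ENNReal.one_ne_top (motive := fun φ => E φ = F φ) ?_ ?_ ?_ φ
    · intro c s hs hμs
      rw [Lp.simpleFunc.coe_indicatorConst]
      have hc : indicatorConstLp 1 hs hμs.ne c = c • indicatorConstLp 1 hs hμs.ne (1 : ℂ) := by
        refine Lp.ext ?_
        filter_upwards [indicatorConstLp_coeFn (p := 1) (hs := hs) (hμs := hμs.ne) (c := c),
          indicatorConstLp_coeFn (p := 1) (hs := hs) (hμs := hμs.ne) (c := (1 : ℂ)),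
          Lp.coeFn_smul c (indicatorConstLp 1 hs hμs.ne (1 : ℂ))] with ω h1 h2 h3
        rw [h1, h3, Pi.smul_apply, h2]
        by_cases hω : ω ∈ s <;> simp [hω]
      rw [hc, map_smul, map_smul, ← hF.setIntegral_eq, hem s hs, hm_apply s hs]
    · intro f g hf hg _ h1 h2
      rw [map_add, map_add, h1, h2]
    · exact isClosed_eq E.continuous F.continuous
  rwa [hEF]

end

end ApproxSpectral

/-! ### Densities over σ-finite measures; from families to operators. -/

namespace ApproxSpectral

section

variable {Ω : Type*} [MeasurableSpace Ω] {μ : Measure Ω} {H : Type*} [NormedAddCommGroup H]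
  [InnerProductSpace ℂ H]

theorem IsIntegralOf.congr {p : ℝ≥0∞} [Fact (1 ≤ p)] {E : Lp ℂ p μ →L[ℂ] H} {e e' : Ω → H}
    (h : IsIntegralOf μ p E e) (he : e =ᵐ[μ] e') : IsIntegralOf μ p E e' := by
  intro φ
  have hae : (fun ω => φ ω • e ω) =ᵐ[μ] fun ω => φ ω • e' ω := by
    filter_upwards [he] with ω hω
    rw [hω]
  exact ⟨(integrable_congr hae).1 (h φ).1, (h φ).2.trans (integral_congr_ae hae)⟩

/-- A bounded operator on `L¹` of a σ-finite measure space with values in a separable Hilbert space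
is an integral operator. -/
theorem exists_stronglyMeasurable_isIntegralOf [SigmaFinite μ] [CompleteSpace H]
    [SecondCountableTopology H] (E : Lp ℂ 1 μ →L[ℂ] H) :
    ∃ e : Ω → H, StronglyMeasurable e ∧ IsIntegralOf μ 1 E e := by
  -- With `w > 0` integrable and `ν = w μ` finite, `u ↦ w u` is an isometry of `L¹(ν)` onto `L¹(μ)`.
  -- A density of the pulled-back operator against `ν` also serves `E` against `μ`, since `u e dν =
  -- (w u) e dμ`.
  obtain ⟨w, hw0, hw, hwlt⟩ := exists_pos_lintegral_lt_of_sigmaFinite μ one_ne_zero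
  let ν := μ.withDensity fun x => (w x : ℝ≥0∞)
  have : IsFiniteMeasure ν := isFiniteMeasure_withDensity hwlt.ne_top
  have hac : μ ≪ ν := withDensity_absolutelyContinuous' (by fun_prop)
    (Filter.Eventually.of_forall fun x => by simpa using (hw0 x).ne')
  let F := withDensitySMulLI (E := ℂ) μ hw
  have hF : ∀ u : Lp ℂ 1 ν, F u =ᵐ[μ] fun x => w x • u x := fun u => by
    rw [withDensitySMulLI_apply]
    exact MemLp.coeFn_toLp _
  -- `F` is only bundled as a real-linear isometry.
  have hFsmul : ∀ (c : ℂ) (u : Lp ℂ 1 ν), F (c • u) = c • F u := by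
    intro c u
    refine Lp.ext ?_
    filter_upwards [hF (c • u), hF u, Lp.coeFn_smul c (F u), hac.ae_le (Lp.coeFn_smul c u)]
      with x h1 h2 h3 h4
    rw [h1, h3, h4, Pi.smul_apply, Pi.smul_apply, h2, smul_comm]
  let E' : Lp ℂ 1 ν →L[ℂ] H := LinearMap.mkContinuous
    { toFun := fun u => E (F u)
      map_add' := fun u v => by rw [map_add, map_add]
      map_smul' := fun c u => by rw [hFsmul, map_smul, RingHom.id_apply] } ‖E‖ fun u => by
        simpa using E.le_opNorm (F u)
  obtain ⟨e, he, -, hE'⟩ := exists_integral_eq_of_isFiniteMeasure E'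
  have he' : AEStronglyMeasurable e μ := he.mono_ac hac
  refine ⟨he'.mk e, he'.stronglyMeasurable_mk, IsIntegralOf.congr ?_ he'.ae_eq_mk⟩
  intro φ
  have hψ : MemLp (fun x => (w x)⁻¹ • φ x) 1 ν := by
    rw [memLp_one_iff_integrable, integrable_withDensity_iff_integrable_smul hw]
    refine (L1.integrable_coeFn φ).congr (Filter.Eventually.of_forall fun x => ?_)
    simp only [smul_inv_smul₀ (hw0 x).ne']
  have hψφ : ∀ᵐ x ∂μ, w x • hψ.toLp _ x = φ x := by
    filter_upwards [hac.ae_le hψ.coeFn_toLp] with x hx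
    rw [hx, smul_inv_smul₀ (hw0 x).ne']
  have hFψ : F (hψ.toLp _) = φ := Lp.ext ((hF _).trans hψφ)
  have hae : (fun x => w x • (hψ.toLp _ x • e x)) =ᵐ[μ] fun x => φ x • e x := by
    filter_upwards [hψφ] with x hx
    rw [← smul_assoc, hx]
  obtain ⟨hint, heq⟩ := hE' (hψ.toLp _)
  refine ⟨((integrable_withDensity_iff_integrable_smul hw).1 hint).congr hae, ?_⟩
  rw [integral_withDensity_eq_integral_smul hw, integral_congr_ae hae] at heq
  rw [← heq]
  exact congrArg E hFψ.symm

/-- The operator with density `e` satisfies `‖E P_U‖ = 1` for all `U` of positive measure exactly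
when `e` consists of unit vectors. -/
theorem IsIntegralOf.norm_comp_indicatorOp_eq_one_iff [SigmaFinite μ] [CompleteSpace H]
    [SecondCountableTopology H] {E : Lp ℂ 1 μ →L[ℂ] H} {e : Ω → H} (h : IsIntegralOf μ 1 E e)
    (he : StronglyMeasurable e) :
    (∀ (U : Set Ω) (hU : MeasurableSet U), 0 < μ U → ‖E.comp (indicatorOp μ 1 hU)‖ = 1) ↔
      ∀ᵐ ω ∂μ, ‖e ω‖ = 1 := by
  constructor
  · intro hE
    have hle : ∀ᵐ ω ∂μ, ‖e ω‖ ≤ 1 := by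
      rcases eq_zero_or_pos (a := μ univ) with h0 | h0
      · rw [Measure.measure_univ_eq_zero.1 h0]
        simp
      · have := (h.comp_indicatorOp MeasurableSet.univ).ae_norm_le
          (he.aestronglyMeasurable.indicator MeasurableSet.univ)
        simpa [hE univ MeasurableSet.univ h0] using this
    -- If the exceptional set `U` had positive measure, the density of `E P_U` would be bounded by
    -- `1 - 1/(n+1)`, contradicting `‖E P_U‖ = 1`.
    have hge : ∀ n : ℕ, ∀ᵐ ω ∂μ, 1 - 1 / ((n : ℝ) + 1) < ‖e ω‖ := by
      intro n
      have hU : MeasurableSet {ω | ‖e ω‖ ≤ 1 - 1 / ((n : ℝ) + 1)} :=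
        measurableSet_le he.norm.measurable measurable_const
      have hn : 0 < 1 / ((n : ℝ) + 1) := Nat.one_div_pos_of_nat
      have hn1 : 0 ≤ 1 - 1 / ((n : ℝ) + 1) := by
        rw [sub_nonneg, div_le_one (by positivity)]
        simp
      by_contra hne
      have hpos : 0 < μ {ω | ‖e ω‖ ≤ 1 - 1 / ((n : ℝ) + 1)} := by
        rw [pos_iff_ne_zero]
        simpa [ae_iff] using hne
      have h1 := (h.comp_indicatorOp hU).norm_le hn1 (Filter.Eventually.of_forall fun ω => by
        by_cases hω : ω ∈ {ω | ‖e ω‖ ≤ 1 - 1 / ((n : ℝ) + 1)}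
        · rw [indicator_of_mem hω]
          exact hω
        · rw [indicator_of_notMem hω, norm_zero]
          exact hn1)
      rw [hE _ hU hpos] at h1
      linarith
    filter_upwards [hle, ae_all_iff.2 hge] with ω h1 h2
    refine le_antisymm h1 (le_of_forall_pos_lt_add fun δ hδ => ?_)
    obtain ⟨n, hn⟩ := exists_nat_one_div_lt hδ
    linarith [h2 n]
  · intro hone U hU hpos
    have hU' := h.comp_indicatorOp hU
    refine le_antisymm (hU'.norm_le zero_le_one ?_) ?_
    · filter_upwards [hone] with ω hω
      exact (norm_indicator_le_norm_self _ _).trans hω.le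
    · have hae := hU'.ae_norm_le (he.aestronglyMeasurable.indicator hU)
      by_contra hlt
      refine hpos.ne' (measure_eq_zero_iff_ae_notMem.2 ?_)
      filter_upwards [hae, hone] with ω h1 h2 hω
      rw [indicator_of_mem hω, h2] at h1
      exact hlt h1

variable [MeasurableSpace H] [BorelSpace H]

/-- Along a pseudo-eigenfamily the pair `(e_ω, A e_ω)` is measurable as a map into the graph. -/
theorem IsPseudoEigenfamily.exists_graph_section [CompleteSpace H] [SecondCountableTopology H]
    {A : H →ₗ.[ℂ] H} (hA : A.IsClosed) {σ : Ω → ℂ} {ε' : ℝ} {N : Set Ω} {e : Ω → H}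
    (h : IsPseudoEigenfamily μ A σ ε' N e) :
    ∃ G : Ω → A.graph, AEStronglyMeasurable G μ ∧
      ∀ ω ∈ Nᶜ, (G ω : H × H).1 = e ω ∧ ‖(G ω : H × H).2 - σ ω • e ω‖ ≤ ε' := by
  classical
  have hex : ∀ ω, ∃ g : A.graph, ω ∈ Nᶜ →
      (g : H × H).1 = e ω ∧ ‖(g : H × H).2 - σ ω • e ω‖ ≤ ε' := by
    intro ω
    by_cases hω : ω ∈ Nᶜ
    · obtain ⟨hdom, hle⟩ := h.residual ω hω
      exact ⟨⟨_, A.mem_graph ⟨e ω, hdom⟩⟩, fun _ => ⟨rfl, hle⟩⟩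
    · exact ⟨0, fun h' => absurd h' hω⟩
  choose G hG using hex
  refine ⟨G, aestronglyMeasurable_of_measurable_compl_null h.null ?_, hG⟩
  have : PolishSpace A.graph := IsClosed.polishSpace (s := (A.graph : Set (H × H))) hA
  -- Lusin–Souslin: the first projection is continuous and injective on the Polish space `A.graph`,
  -- so measurability of `e` lifts to `G` although `A` need not be continuous.
  have hemb : MeasurableEmbedding fun g : A.graph => (g : H × H).1 := by
    refine Continuous.measurableEmbedding (by fun_prop) fun g g' hgg' => ?_
    exact Subtype.ext (Prod.ext hgg' (A.mem_graph_snd_inj g.2 g'.2 hgg'))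
  rw [← hemb.measurable_comp_iff]
  convert! h.measurable using 1
  ext ω
  exact (hG ω ω.2).1

theorem IsPseudoEigenfamily.aestronglyMeasurable [SecondCountableTopology H]
    {A : H →ₗ.[ℂ] H} {σ : Ω → ℂ} {ε' : ℝ} {N : Set Ω} {e : Ω → H}
    (h : IsPseudoEigenfamily μ A σ ε' N e) : AEStronglyMeasurable e μ :=
  aestronglyMeasurable_of_measurable_compl_null h.null h.measurable

/-- The Bochner integral of `φ G` is taken inside the graph, which is complete because `A` is
closed. Its components are `E φ` and `∫ φ A e`, so `E φ ∈ Dom A` and `A` passes under the integral.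
-/
theorem IsPseudoEigenfamily.commutatorNormLT [CompleteSpace H] [SecondCountableTopology H]
    {A : H →ₗ.[ℂ] H} (hA : A.IsClosed) {σ : Ω → ℂ} {ε ε' : ℝ}
    (hε' : 0 ≤ ε') (hεε' : ε' < ε) {N : Set Ω} {e : Ω → H}
    (h : IsPseudoEigenfamily μ A σ ε' N e) {E : Lp ℂ 1 μ →L[ℂ] H} (hE : IsIntegralOf μ 1 E e) :
    CommutatorNormLT A (multOp μ 1 σ) E ε := by
  obtain ⟨G, hGm, hG⟩ := h.exists_graph_section hA
  have hN : ∀ᵐ ω ∂μ, ω ∈ Nᶜ := measure_eq_zero_iff_ae_notMem.1 h.null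
  have : CompleteSpace A.graph := IsComplete.completeSpace_coe (s := (A.graph : Set (H × H)))
    (IsClosed.isComplete hA)
  have key : ∀ φ : (multOp μ 1 σ).domain, ∃ hdom : E φ ∈ A.domain,
      ‖A ⟨E φ, hdom⟩ - E (multOp μ 1 σ φ)‖ ≤ ε' * ‖(φ : Lp ℂ 1 μ)‖ := by
    intro φ
    have hφ := L1.integrable_coeFn (φ : Lp ℂ 1 μ)
    have hσφ : Integrable (fun ω => σ ω * (φ : Lp ℂ 1 μ) ω) μ :=
      memLp_one_iff_integrable.1 (memLp_of_mem_multDomain μ 1 φ)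
    -- Here `φ ∈ Dom Λ` is needed: `‖G‖ ≤ 1 + ε' + ‖σ‖`, so `σ φ` must be integrable.
    have hint : Integrable (fun ω => (φ : Lp ℂ 1 μ) ω • G ω) μ := by
      refine Integrable.mono' ((hφ.norm.const_mul (1 + ε')).add hσφ.norm)
        (hφ.aestronglyMeasurable.smul hGm) ?_
      filter_upwards [hN] with ω hω
      obtain ⟨h1, h2⟩ := hG ω hω
      have h3 : ‖(G ω : H × H).2‖ ≤ ε' + ‖σ ω‖ := by
        have := norm_le_norm_add_norm_sub' (G ω : H × H).2 (σ ω • e ω)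
        rw [norm_smul, h.norm_eq_one ω hω, mul_one] at this
        linarith
      have h4 : ‖G ω‖ ≤ 1 + ε' + ‖σ ω‖ := by
        rw [Submodule.coe_norm, Prod.norm_def]
        refine max_le ?_ (by linarith)
        rw [h1, h.norm_eq_one ω hω]
        linarith [norm_nonneg (σ ω)]
      rw [norm_smul, Pi.add_apply, norm_mul]
      nlinarith [norm_nonneg ((φ : Lp ℂ 1 μ) ω)]
    let P : A.graph := ∫ ω, (φ : Lp ℂ 1 μ) ω • G ω ∂μ
    have h1 : (P : H × H).1 = E φ := by
      rw [(hE φ).2]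
      change (ContinuousLinearMap.fst ℂ H H ∘L A.graph.subtypeL) P = _
      rw [← ContinuousLinearMap.integral_comp_comm _ hint]
      refine integral_congr_ae ?_
      filter_upwards [hN] with ω hω
      rw [map_smul]
      exact congrArg _ (hG ω hω).1
    have h2int : Integrable (fun ω => (φ : Lp ℂ 1 μ) ω • (G ω : H × H).2) μ :=
      (ContinuousLinearMap.snd ℂ H H ∘L A.graph.subtypeL).integrable_comp hint
    have h2 : (P : H × H).2 = ∫ ω, (φ : Lp ℂ 1 μ) ω • (G ω : H × H).2 ∂μ := by
      change (ContinuousLinearMap.snd ℂ H H ∘L A.graph.subtypeL) P = _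
      rw [← ContinuousLinearMap.integral_comp_comm _ hint]
      rfl
    obtain ⟨y, hy1, hy2⟩ := A.mem_graph_iff.1 P.2
    have hdom : E φ ∈ A.domain := h1 ▸ hy1 ▸ y.2
    have hy : y = ⟨E φ, hdom⟩ := Subtype.ext (hy1.trans h1)
    refine ⟨hdom, ?_⟩
    rw [← hy, hy2, h2, (hE _).2, ← integral_sub h2int (hE _).1]
    have hae : (fun ω => (φ : Lp ℂ 1 μ) ω • (G ω : H × H).2 - multOp μ 1 σ φ ω • e ω) =ᵐ[μ]
        fun ω => (φ : Lp ℂ 1 μ) ω • ((G ω : H × H).2 - σ ω • e ω) := by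
      filter_upwards [multOp_coeFn φ] with ω hω
      rw [hω, smul_sub, smul_smul, mul_comm]
    rw [integral_congr_ae hae]
    refine norm_integral_smul_le ?_
    filter_upwards [hN] with ω hω
    exact (hG ω hω).2
  exact ⟨fun φ => (key φ).1, ε', hε', hεε', fun φ => (key φ).2⟩

theorem IsPseudoEigenfamily.isApproxDiagonalization [SigmaFinite μ] [CompleteSpace H]
    [SecondCountableTopology H] {A : H →ₗ.[ℂ] H} (hA : A.IsClosed) {σ : Ω → ℂ} {ε ε' : ℝ}
    (hε' : 0 ≤ ε') (hεε' : ε' < ε) {N : Set Ω} {e : Ω → H}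
    (h : IsPseudoEigenfamily μ A σ ε' N e) {E : Lp ℂ 1 μ →L[ℂ] H} (hE : IsIntegralOf μ 1 E e) :
    IsApproxDiagonalization μ 1 A σ ε E where
  norm_comp_indicatorOp := by
    have he := h.aestronglyMeasurable
    refine ((hE.congr he.ae_eq_mk).norm_comp_indicatorOp_eq_one_iff he.stronglyMeasurable_mk).2 ?_
    filter_upwards [he.ae_eq_mk, measure_eq_zero_iff_ae_notMem.1 h.null] with ω h1 h2
    rw [← h1]
    exact h.norm_eq_one ω h2
  commutator := h.commutatorNormLT hA hε' hεε' hE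

end

end ApproxSpectral

/-! ### From operators to families. -/

namespace ApproxSpectral

section

variable {Ω : Type*} [MeasurableSpace Ω] {μ : Measure Ω} {H : Type*} [NormedAddCommGroup H]
  [InnerProductSpace ℂ H]

theorem indicatorOp_mem_multDomain {p : ℝ≥0∞} [Fact (1 ≤ p)] {σ : Ω → ℂ} (hσ : Measurable σ)
    {S : Set Ω} (hS : MeasurableSet S) {c : ℝ} (hc : ∀ ω ∈ S, ‖σ ω‖ ≤ c) (φ : Lp ℂ p μ) :
    indicatorOp μ p hS φ ∈ multDomain μ p σ := by
  -- `c` may be negative when `S` is empty.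
  refine MemLp.of_le_mul (c := max c 0) (Lp.memLp φ)
    (hσ.aestronglyMeasurable.mul (Lp.aestronglyMeasurable _)) ?_
  filter_upwards [indicatorOp_coeFn hS φ] with ω hω
  rw [hω, norm_mul]
  by_cases h : ω ∈ S
  · rw [indicator_of_mem h]
    exact mul_le_mul_of_nonneg_right (le_max_of_le_left (hc ω h)) (norm_nonneg _)
  · rw [indicator_of_notMem h, norm_zero, mul_zero]
    positivity

/-- If `A E - E Λ` is bounded by `C` and `E` has density `e`, then on a set where `σ` is bounded,
`e` takes values in `Dom A` and `‖A e - σ e‖ ≤ C` almost everywhere. -/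
theorem IsIntegralOf.ae_residual_le_of_bounded [SigmaFinite μ] [CompleteSpace H]
    [SecondCountableTopology H] {A : H →ₗ.[ℂ] H} (hA : A.IsClosed) {σ : Ω → ℂ}
    (hσ : Measurable σ) {E : Lp ℂ 1 μ →L[ℂ] H} {e : Ω → H} (hE : IsIntegralOf μ 1 E e)
    (he : StronglyMeasurable e) (hdom : ∀ φ : (multOp μ 1 σ).domain, E φ ∈ A.domain) {C : ℝ}
    (hC : 0 ≤ C) (hAE : ∀ φ : (multOp μ 1 σ).domain,
      ‖A ⟨E φ, hdom φ⟩ - E (multOp μ 1 σ φ)‖ ≤ C * ‖(φ : Lp ℂ 1 μ)‖)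
    {S : Set Ω} (hS : MeasurableSet S) {c : ℝ} (hc : ∀ ω ∈ S, ‖σ ω‖ ≤ c) :
    ∀ᵐ ω ∂μ, ω ∈ S → ∃ h : e ω ∈ A.domain, ‖A ⟨e ω, h⟩ - σ ω • e ω‖ ≤ C := by
  have hPle : ‖indicatorOp μ 1 hS‖ ≤ 1 := LinearMap.mkContinuous_norm_le _ zero_le_one _
  let ι : Lp ℂ 1 μ →ₗ[ℂ] (multOp μ 1 σ).domain :=
    LinearMap.codRestrict _ (indicatorOp μ 1 hS).toLinearMap
      (indicatorOp_mem_multDomain hσ hS hc)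
  let T : (multOp μ 1 σ).domain →ₗ[ℂ] A.domain :=
    LinearMap.codRestrict _ (E.toLinearMap ∘ₗ Submodule.subtype _) hdom
  -- `D = (A E - E Λ) P_S` is defined on all of `L¹`, since `P_S` maps into `Dom Λ`; so it has a
  -- density `d` with `‖d‖ ≤ C` a.e.
  let D : Lp ℂ 1 μ →L[ℂ] H := LinearMap.mkContinuous
    ((A.toFun ∘ₗ T - E.toLinearMap ∘ₗ (multOp μ 1 σ).toFun) ∘ₗ ι) C fun φ => by
      refine (hAE (ι φ)).trans (mul_le_mul_of_nonneg_left ?_ hC)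
      exact (indicatorOp μ 1 hS).le_of_opNorm_le hPle φ |>.trans_eq (one_mul _)
  have hD : ∀ φ, A ⟨E (ι φ), hdom (ι φ)⟩ = D φ + E (multOp μ 1 σ (ι φ)) := fun φ =>
    (sub_add_cancel _ _).symm
  obtain ⟨d, hd, hDd⟩ := exists_stronglyMeasurable_isIntegralOf D
  have hdC : ∀ᵐ ω ∂μ, ‖d ω‖ ≤ C := by
    filter_upwards [hDd.ae_norm_le hd.aestronglyMeasurable] with ω hω
    exact hω.trans (LinearMap.mkContinuous_norm_le _ hC _)
  let g : Ω → H := S.indicator fun ω => σ ω • e ω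
  have hg : StronglyMeasurable g := (hσ.stronglyMeasurable.smul he).indicator hS
  -- The integral of this pair over `s` is `(E P_S 1_s, A E P_S 1_s)`, a point of the closed graph.
  -- On `S` the conclusion reads `A e = d + σ e`.
  have hmem : ∀ᵐ ω ∂μ, (S.indicator e ω, d ω + g ω) ∈ (A.graph : Set (H × H)) := by
    refine ae_mem_of_forall_setAverage_mem
      ((he.indicator hS).prodMk (hd.add hg)).aestronglyMeasurable hA fun s hs _ hμs hint => ?_
    let φ : Lp ℂ 1 μ := indicatorConstLp 1 hs hμs.ne 1
    have h1 : ∫ ω in s, S.indicator e ω ∂μ = E (ι φ) :=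
      (hE.comp_indicatorOp hS).setIntegral_eq hs hμs.ne
    have h2 : ∫ ω in s, d ω ∂μ = D φ := hDd.setIntegral_eq hs hμs.ne
    have hae : (fun ω => multOp μ 1 σ (ι φ) ω • e ω) =ᵐ[μ] s.indicator g := by
      filter_upwards [multOp_coeFn (ι φ), indicatorOp_coeFn hS φ,
        indicatorConstLp_coeFn (p := 1) (hs := hs) (hμs := hμs.ne) (c := (1 : ℂ))] with ω a1 a2 a3
      have a4 : (ι φ : Lp ℂ 1 μ) ω = S.indicator φ ω := a2
      rw [a1, a4]
      by_cases hωS : ω ∈ S <;> by_cases hωs : ω ∈ s <;> simp [g, hωS, hωs, φ, a3]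
    have h3 : ∫ ω in s, g ω ∂μ = E (multOp μ 1 σ (ι φ)) := by
      rw [(hE _).2, integral_congr_ae hae, integral_indicator hs]
    have hgint : IntegrableOn g s μ := by
      rw [← integrable_indicator_iff hs]
      exact (integrable_congr hae).1 (hE _).1
    have hsnd : IntegrableOn (fun ω => d ω + g ω) s μ := hint.snd
    have hfst : IntegrableOn (fun ω => S.indicator e ω) s μ := hint.fst
    have hdint : IntegrableOn d s μ := by
      refine (hsnd.sub hgint).congr (Filter.Eventually.of_forall fun ω => ?_)
      exact add_sub_cancel_right _ _
    rw [setAverage_eq]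
    refine A.graph.smul_of_tower_mem _ ?_
    change ∫ ω in s, (S.indicator e ω, d ω + g ω) ∂μ ∈ A.graph
    rw [integral_pair hfst hsnd, integral_add hdint hgint, h1, h2, h3, ← hD]
    exact A.mem_graph ⟨E (ι φ), hdom (ι φ)⟩
  filter_upwards [hmem, hdC] with ω h1 h2 hω
  obtain ⟨y, hy1, hy2⟩ := A.mem_graph_iff.1 h1
  simp only [indicator_of_mem hω, g] at hy1 hy2
  have hy : y = ⟨e ω, hy1 ▸ y.2⟩ := Subtype.ext hy1
  refine ⟨hy1 ▸ y.2, ?_⟩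
  rwa [← hy, hy2, add_sub_cancel_right]

/-- The sets `{‖σ‖ ≤ n}` exhaust `Ω`, so the residual bound on each of them holds a.e. on `Ω`. -/
theorem IsApproxDiagonalization.exists_isPseudoEigenfamily [SigmaFinite μ] [CompleteSpace H]
    [SecondCountableTopology H] [MeasurableSpace H] [BorelSpace H] {A : H →ₗ.[ℂ] H}
    (hA : A.IsClosed) {σ : Ω → ℂ} (hσ : Measurable σ) {ε : ℝ} (hε : 0 < ε)
    {E : Lp ℂ 1 μ →L[ℂ] H} (h : IsApproxDiagonalization μ 1 A σ ε E) :
    ∃ (ε' : ℝ) (N : Set Ω) (e : Ω → H), 0 < ε' ∧ ε' < ε ∧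
      IsPseudoEigenfamily μ A σ ε' N e ∧ IsIntegralOf μ 1 E e := by
  obtain ⟨e, he, hE⟩ := exists_stronglyMeasurable_isIntegralOf E
  have hone := (hE.norm_comp_indicatorOp_eq_one_iff he).1 h.norm_comp_indicatorOp
  obtain ⟨hdom, C, hC, hCε, hAE⟩ := h.commutator
  have hres : ∀ᵐ ω ∂μ, ∃ h : e ω ∈ A.domain, ‖A ⟨e ω, h⟩ - σ ω • e ω‖ ≤ C := by
    have := ae_all_iff.2 fun n : ℕ => hE.ae_residual_le_of_bounded hA hσ he hdom hC hAE
      (measurableSet_le hσ.norm measurable_const : MeasurableSet {ω | ‖σ ω‖ ≤ n}) fun _ hω => hω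
    filter_upwards [this] with ω hω
    obtain ⟨n, hn⟩ := exists_nat_ge ‖σ ω‖
    exact hω n hn
  -- `C` may be 0 whereas `ε'` must be positive, hence the maximum with `ε / 2`. `N` is the set
  -- where a required property fails.
  refine ⟨max C (ε / 2), {ω | ‖e ω‖ = 1 ∧
    ∃ h : e ω ∈ A.domain, ‖A ⟨e ω, h⟩ - σ ω • e ω‖ ≤ C}ᶜ, e, lt_max_of_lt_right (half_pos hε),
    max_lt hCε (half_lt_self hε), ⟨?_, ?_, ?_, ?_⟩, hE⟩
  · filter_upwards [hone, hres] with ω h1 h2 using ⟨h1, h2⟩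
  · exact he.measurable.comp measurable_subtype_coe
  · intro ω hω
    rw [compl_compl] at hω
    exact hω.1
  · intro ω hω
    rw [compl_compl] at hω
    obtain ⟨hd, hle⟩ := hω.2
    exact ⟨hd, hle.trans (le_max_left _ _)⟩

end

end ApproxSpectral

theorem mainTheorem3
    {Ω : Type*} [MeasurableSpace Ω] (μ : Measure Ω) [SigmaFinite μ]
    {H : Type*} [NormedAddCommGroup H] [InnerProductSpace ℂ H] [CompleteSpace H]
    [TopologicalSpace.SeparableSpace H] [MeasurableSpace H] [BorelSpace H]
    (A : H →ₗ.[ℂ] H) (hA : A.IsClosed)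
    (σ : Ω → ℂ) (hσ : Measurable σ) (ε : ℝ) (hε : 0 < ε) :
    ((∃ E : Lp ℂ 1 μ →L[ℂ] H, ApproxSpectral.IsApproxDiagonalization μ 1 A σ ε E) ↔
      ∃ (ε' : ℝ) (N : Set Ω) (e : Ω → H), 0 < ε' ∧ ε' < ε ∧
        ApproxSpectral.IsPseudoEigenfamily μ A σ ε' N e) ∧
    (∀ E : Lp ℂ 1 μ →L[ℂ] H, ApproxSpectral.IsApproxDiagonalization μ 1 A σ ε E ↔
      ∃ (ε' : ℝ) (N : Set Ω) (e : Ω → H), 0 < ε' ∧ ε' < ε ∧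
        ApproxSpectral.IsPseudoEigenfamily μ A σ ε' N e ∧
        ApproxSpectral.IsIntegralOf μ 1 E e) ∧
    (∀ (ε' : ℝ) (N : Set Ω) (e : Ω → H), 0 < ε' → ε' < ε →
      ApproxSpectral.IsPseudoEigenfamily μ A σ ε' N e →
      ∃ E : Lp ℂ 1 μ →L[ℂ] H, ApproxSpectral.IsApproxDiagonalization μ 1 A σ ε E ∧
        ApproxSpectral.IsIntegralOf μ 1 E e) := by
  have : SecondCountableTopology H := UniformSpace.secondCountable_of_separable H
  have hforward : ∀ (ε' : ℝ) (N : Set Ω) (e : Ω → H), 0 < ε' → ε' < ε →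
      ApproxSpectral.IsPseudoEigenfamily μ A σ ε' N e →
      ∃ E : Lp ℂ 1 μ →L[ℂ] H, ApproxSpectral.IsApproxDiagonalization μ 1 A σ ε E ∧
        ApproxSpectral.IsIntegralOf μ 1 E e := by
    intro ε' N e hε' hεε' h
    have hbound : ∀ᵐ ω ∂μ, ‖e ω‖ ≤ 1 := by
      filter_upwards [measure_eq_zero_iff_ae_notMem.1 h.null] with ω hω
      exact (h.norm_eq_one ω hω).le
    obtain ⟨E, hE⟩ := ApproxSpectral.exists_isIntegralOf h.aestronglyMeasurable hbound
    exact ⟨E, h.isApproxDiagonalization hA hε'.le hεε' hE, hE⟩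
  refine ⟨⟨?_, ?_⟩, fun E => ⟨fun h => h.exists_isPseudoEigenfamily hA hσ hε, ?_⟩, hforward⟩
  · rintro ⟨E, hE⟩
    obtain ⟨ε', N, e, h1, h2, h3, -⟩ := hE.exists_isPseudoEigenfamily hA hσ hε
    exact ⟨ε', N, e, h1, h2, h3⟩
  · rintro ⟨ε', N, e, h1, h2, h3⟩
    obtain ⟨E, hE, -⟩ := hforward ε' N e h1 h2 h3
    exact ⟨E, hE⟩
  · rintro ⟨ε', N, e, h1, h2, h3, h4⟩
    exact h3.isApproxDiagonalization hA h1.le h2 h4
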